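/- \textbf{Setting.} Let $n,d\ge 1$. For each $i\in\{1,\dots,n\}$ let $\gamma_i:\mathbb S^{d-1}\to\mathbb R$ be a directional function, i.e. continuous and bounded above and below by positive constants; put $\mathbb S^{d-1}_{\gamma_i}=\{\gamma_i(x)x: x\in\mathbb S^{d-1}\}$ and let $\mathbb S(n,d,\bar\gamma)$ be the set of matrices $X\in\mathbb R^{n\times d}$ whose $i$-th row $[X]_i$ lies in $\mathbb S^{d-1}_{\gamma_i}$ for every $i$. For a matrix $B\in\mathbb R^{n\times d}$ with nonzero rows let $P(B)$ be the matrix with rows $$[P(B)]_i=\gamma_i\!\left(\tfrac{[B]_i}{\|[B]_i\|_2}\right)\tfrac{[B]_i}{\|[B]_i\|_2},$$ and let $D(B)$ be the diagonal matrix with diagonal entries $\gamma_i\big([B]_i/\|[B]_i\|_2\big)/\|[B]_i\|_2$, so that $P(B)=D(B)B$. Let $A=[a_{ij}]\in\mathbb R^{n\times n}$ be a nonnegative weight matrix of a strongly connected directed graph on $\{1,\dots,n\}$ (self-loops allowed), i.e. $a_{ij}>0$ if $(i,j)$ is an edge and $a_{ij}=0$ otherwise, and assume $$a_{ii}\min_{x\in\mathbb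 S^{d-1}}\gamma_i(x)>\sum_{j\ne i}a_{ij}\max_{x\in\mathbb S^{d-1}}\gamma_j(x)\qquad\text{for all } i.$$ Let $X(t_0)=X_0\in\mathbb S(n,d,\bar\gamma)$ and $X(t+1)=P(AX(t))$ for all integers $t\ge t_0\ge 0$, let $x_i(t)=[X(t)]_i$, and let $\tilde A(k,t_0,X_0)=D(AX(t_0+k-1))A\cdots D(AX(t_0))A$, so that $X(t_0+k)=\tilde A(k,t_0,X_0)X_0$. A sequence $(z_k)$ is said to converge linearly to $z$ if there are $C\ge 0$ and $\rho\in(0,1)$ with $\|z_k-z\|_2\le C\rho^k$ for all $k$. \textbf{Theorem.} There is exactly one continuous function $v$ from $\mathbb S(n,d,\bar\gamma)$ to the set of unit vectors of $\mathbb R^n$ with positive entries such that, for all $t_0$, all $X_0\in\mathbb S(n,d,\bar\gamma)$ and all $i$, the normalized rows $[\tilde A(k,t_0,X_0)]_i/\|[\tilde A(k,t_0,X_0)]_i\|_2$ converge linearly to $v(X_0)$ as $k\to\infty$. With this $v$ (a row vector), the following holds for all $t_0$ and $X_0$. There is asymptotic consensus of directions, i.e. $$\left\|\frac{x_i(t)}{\|x_i(t)\|_2}-\frac{x_j(t)}{\|x_j(t)\|_2}\right\|_2\to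 0\quad (t\to\infty)\quad\text{for all } i,j,$$ if and only if $v(X_0)X_0\neq 0$. If $v(X_0)X_0\ne0$, then moreover: \begin{enumerate} \item for every $i$, $x_i(t)/\|x_i(t)\|_2$ converges, and converges linearly, to $u:=v(X_0)X_0/\|v(X_0)X_0\|_2$; \item $X(t)$ converges to $P(\mathbf 1_{n,1}\,v(X_0)X_0)$, the matrix with rows $\gamma_i(u)u$; and if each $\gamma_i$ is differentiable at $u$ (as a function on the sphere), then each row $x_i(t)$ converges linearly to $\gamma_i(u)u$. \end{enumerate} -/

import Mathlib

open Filter Topology Metric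

noncomputable section

namespace StarConsensus

/-- A directed graph (loops allowed) is strongly connected if every node can be reached from every
node along directed edges. -/
def StronglyConnected {n : ℕ} (G : Digraph (Fin n)) : Prop :=
  ∀ i j, Relation.ReflTransGen G.Adj i j

/-- `A` is a nonnegative weight matrix for `G`: its entries are positive on the edges of `G` and
zero elsewhere. -/
def IsNonnegWeightMatrix {n : ℕ} (G : Digraph (Fin n)) (A : Matrix (Fin n) (Fin n) ℝ) : Prop :=
  ∀ i j, (G.Adj i j → 0 < A i j) ∧ (¬ G.Adj i j → A i j = 0)

/-- A directional function on the Euclidean unit sphere: continuous, and bounded from above and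
from below by positive constants. Only the values of `γ` on the sphere matter. -/
def IsDirectional {d : ℕ} (γ : EuclideanSpace ℝ (Fin d) → ℝ) : Prop :=
  ContinuousOn γ (sphere 0 1) ∧ ∃ c C : ℝ, 0 < c ∧ ∀ x ∈ sphere 0 1, c ≤ γ x ∧ γ x ≤ C

/-- The minimum of a directional function over the unit sphere (attained, by compactness). -/
def sphereMin {d : ℕ} (γ : EuclideanSpace ℝ (Fin d) → ℝ) : ℝ := sInf (γ '' sphere 0 1)

/-- The maximum of a directional function over the unit sphere (attained, by compactness). -/
def sphereMax {d : ℕ} (γ : EuclideanSpace ℝ (Fin d) → ℝ) : ℝ := sSup (γ '' sphere 0 1)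

/-- The diagonal dominance condition of `A` relative to the directional functions. -/
def DominanceCondition {n d : ℕ} (A : Matrix (Fin n) (Fin n) ℝ)
    (γ : Fin n → EuclideanSpace ℝ (Fin d) → ℝ) : Prop :=
  ∀ i, ∑ j ∈ Finset.univ.erase i, A i j * sphereMax (γ j) < A i i * sphereMin (γ i)

/-- The `i`-th row of a matrix, as a vector with the Euclidean norm. -/
def row {m d : ℕ} (X : Matrix (Fin m) (Fin d) ℝ) (i : Fin m) : EuclideanSpace ℝ (Fin d) :=
  WithLp.toLp 2 (X i)

/-- The direction `x / ‖x‖₂` of a nonzero vector. -/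
def dir {d : ℕ} (x : EuclideanSpace ℝ (Fin d)) : EuclideanSpace ℝ (Fin d) := ‖x‖⁻¹ • x

/-- The star boundary of a directional function. -/
def starBoundary {d : ℕ} (γ : EuclideanSpace ℝ (Fin d) → ℝ) : Set (EuclideanSpace ℝ (Fin d)) :=
  {y | ∃ x ∈ sphere (0 : EuclideanSpace ℝ (Fin d)) 1, y = γ x • x}

/-- The matrices whose `i`-th row lies on the star boundary of `γ i`, for every `i`. -/
def stateSpace {n d : ℕ} (γ : Fin n → EuclideanSpace ℝ (Fin d) → ℝ) :
    Set (Matrix (Fin n) (Fin d) ℝ) :=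
  {X | ∀ i, row X i ∈ starBoundary (γ i)}

/-- The radial projection of a nonzero vector onto the star boundary of `γ`. -/
def radialProj {d : ℕ} (γ : EuclideanSpace ℝ (Fin d) → ℝ) (x : EuclideanSpace ℝ (Fin d)) :
    EuclideanSpace ℝ (Fin d) :=
  γ (dir x) • dir x

/-- The row-wise radial projection. -/
def proj {n d : ℕ} (γ : Fin n → EuclideanSpace ℝ (Fin d) → ℝ) (X : Matrix (Fin n) (Fin d) ℝ) :
    Matrix (Fin n) (Fin d) ℝ :=
  Matrix.of fun i j => radialProj (γ i) (row X i) j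

/-- `X` is generated by the algorithm `X (t + 1) = proj (A X (t))` from time `t₀` on, with initial
state `X t₀` in the state space. -/
def IsTrajectory {n d : ℕ} (A : Matrix (Fin n) (Fin n) ℝ)
    (γ : Fin n → EuclideanSpace ℝ (Fin d) → ℝ) (t₀ : ℕ) (X : ℕ → Matrix (Fin n) (Fin d) ℝ) :
    Prop :=
  X t₀ ∈ stateSpace γ ∧ ∀ t, t₀ ≤ t → X (t + 1) = proj γ (A * X t)

/-- The positive diagonal matrix of the scaling factors used by the radial projection:
`proj γ B = scaling γ B * B` if `B` has nonzero rows. -/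
def scaling {n d : ℕ} (γ : Fin n → EuclideanSpace ℝ (Fin d) → ℝ)
    (B : Matrix (Fin n) (Fin d) ℝ) : Matrix (Fin n) (Fin n) ℝ :=
  Matrix.diagonal fun i => γ i (dir (row B i)) / ‖row B i‖

/-- The matrix product
`(D (A X (t₀ + k - 1)) A) ⋯ (D (A X (t₀ + 1)) A) (D (A X (t₀)) A)`, with `D = scaling γ`,
along the sequence `X`; it transforms `X (t₀)` into `X (t₀ + k)` if `X` is a trajectory. -/
def transition {n d : ℕ} (A : Matrix (Fin n) (Fin n) ℝ)
    (γ : Fin n → EuclideanSpace ℝ (Fin d) → ℝ) (t₀ : ℕ) (X : ℕ → Matrix (Fin n) (Fin d) ℝ) :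
    ℕ → Matrix (Fin n) (Fin n) ℝ
  | 0 => 1
  | k + 1 => (scaling γ (A * X (t₀ + k)) * A) * transition A γ t₀ X k

/-- Linear convergence: the distance to the limit is at most a constant times the `k`-th power of
a ratio smaller than one. -/
def ConvergesLinearly {d : ℕ} (x : ℕ → EuclideanSpace ℝ (Fin d))
    (l : EuclideanSpace ℝ (Fin d)) : Prop :=
  ∃ C ρ : ℝ, 0 < ρ ∧ ρ < 1 ∧ ∀ k, ‖x k - l‖ ≤ C * ρ ^ k

/-- `v` is a continuous function from the state space to the positive unit vectors of `ℝⁿ` such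
that, along every trajectory, every normalized row of the transition matrices converges linearly
to the value of `v` at the initial state. -/
def IsLimitVector {n d : ℕ} (A : Matrix (Fin n) (Fin n) ℝ)
    (γ : Fin n → EuclideanSpace ℝ (Fin d) → ℝ)
    (v : stateSpace γ → EuclideanSpace ℝ (Fin n)) : Prop :=
  Continuous v ∧
  (∀ X₀, ‖v X₀‖ = 1 ∧ ∀ i, 0 < v X₀ i) ∧
  ∀ (t₀ : ℕ) (X : ℕ → Matrix (Fin n) (Fin d) ℝ) (hX : IsTrajectory A γ t₀ X) (i : Fin n),
    ConvergesLinearly (fun k => dir (row (transition A γ t₀ X k) i)) (v ⟨X t₀, hX.1⟩)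

/-- The product of a row vector with a matrix, as a vector with the Euclidean norm. -/
def rowMul {n d : ℕ} (w : EuclideanSpace ℝ (Fin n)) (X : Matrix (Fin n) (Fin d) ℝ) :
    EuclideanSpace ℝ (Fin d) :=
  WithLp.toLp 2 (Matrix.vecMul w.ofLp X)

/-- Asymptotic consensus of directions. -/
def DirectionConsensus {n d : ℕ} (X : ℕ → Matrix (Fin n) (Fin d) ℝ) : Prop :=
  ∀ i j, Tendsto (fun t => ‖dir (row (X t) i) - dir (row (X t) j)‖) atTop (𝓝 0)

end StarConsensus

end

open StarConsensus

/-!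
By diagonal dominance `A X` has nonzero rows whose norms are bounded, and bounded away from zero,
on the state space (`exists_scaling_bounds`). So the matrices `M X = scaling γ (A X) * A` satisfy
`δ A ≤ M X ≤ Δ A` entrywise, with `δ > 0`. As `A` is nonnegative with positive diagonal and a
strongly connected graph, some power `A ^ N` is positive (`exists_pow_apply_pos`), and hence all
`N`-step products of the matrices `M X` have entries in a fixed interval `[ε, E]` with `ε > 0`.

The existence of `v` is an ergodicity argument. If `T k` is the transition matrix, consider for a
fixed column `c` the ratios `T k i c / ∑ c', T k i c'`. Multiplication by a nonnegative matrix
replaces them by weighted means, so the interval they span is nested in `k`; an `N`-step product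
gives at least the weight `ε / E` to one common mean, so every `N` steps the interval shrinks by
the factor `1 - ε / E` (`exists_ratio_limit`). The ratios therefore have a limit that does not
depend on the row, at a linear rate which is uniform in the initial state; the limit is continuous
as a uniform limit, and positive because the ratios at time `N` are. Normalizing it gives `v`
(`exists_limit_direction`, `exists_isLimitVector`). Uniqueness holds because limits are unique.

Since `X (t₀ + k) = T k * X t₀`, the direction of the `i`-th row of the state is that of
`dir (row (T k) i) * X t₀`, and `dir` is Lipschitz around nonzero vectors; so `v X₀ * X₀ ≠ 0` gives
linear convergence of the directions. The rows are the values of `z ↦ γ i z • z` at these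
directions, which settles their convergence, and its linear rate where `γ i` is differentiable.

Conversely, `v X₀` is a positive multiple of `v (X (t₀ + k)) * T k`
(`IsLimitVector.eq_dir_rowMul`), so `v X₀ * X₀` is one of `v (X (t₀ + k)) * X (t₀ + k)`. Under
consensus the rows of `X (t₀ + k)` lie in an open half-space for large `k`, so their combination
with the positive coefficients `v (X (t₀ + k))` is not zero
(`IsLimitVector.rowMul_ne_zero_of_directionConsensus`).
-/

namespace StarConsensus

/-! ### Products of nonnegative matrices -/

section Nonnegative

variable {ι κ : Type*} [Fintype ι]

lemma mulVec_le_mulVec {B : Matrix κ ι ℝ} (hB : ∀ i j, 0 ≤ B i j) {x y : ι → ℝ} (h : x ≤ y) :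
    B.mulVec x ≤ B.mulVec y := fun i =>
  Finset.sum_le_sum fun j _ => mul_le_mul_of_nonneg_left (h j) (hB i j)

lemma mul_apply_mono {l : Type*} {B B' : Matrix κ ι ℝ} {D D' : Matrix ι l ℝ}
    (hB : ∀ i j, 0 ≤ B i j) (hD : ∀ i j, 0 ≤ D i j) (hBB' : ∀ i j, B i j ≤ B' i j)
    (hDD' : ∀ i j, D i j ≤ D' i j) (i : κ) (j : l) : (B * D) i j ≤ (B' * D') i j := by
  simp only [Matrix.mul_apply]
  exact Finset.sum_le_sum fun m _ =>
    mul_le_mul (hBB' i m) (hDD' m j) (hD m j) ((hB i m).trans (hBB' i m))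

lemma mul_apply_nonneg {l : Type*} {B : Matrix κ ι ℝ} {D : Matrix ι l ℝ}
    (hB : ∀ i j, 0 ≤ B i j) (hD : ∀ i j, 0 ≤ D i j) (i : κ) (j : l) : 0 ≤ (B * D) i j := by
  simp only [Matrix.mul_apply]
  exact Finset.sum_nonneg fun m _ => mul_nonneg (hB i m) (hD m j)

lemma mul_apply_pos {l : Type*} {B : Matrix κ ι ℝ} {D : Matrix ι l ℝ}
    (hB : ∀ i j, 0 ≤ B i j) (hD : ∀ i j, 0 ≤ D i j) {i : κ} {j : l} (m : ι)
    (h1 : 0 < B i m) (h2 : 0 < D m j) : 0 < (B * D) i j := by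
  simp only [Matrix.mul_apply]
  exact Finset.sum_pos' (fun m _ => mul_nonneg (hB i m) (hD m j))
    ⟨m, Finset.mem_univ _, mul_pos h1 h2⟩

lemma pow_apply_nonneg [DecidableEq ι] {A : Matrix ι ι ℝ} (hA : ∀ i j, 0 ≤ A i j) (k : ℕ) :
    ∀ i j, 0 ≤ (A ^ k) i j := by
  induction k with
  | zero => intro i j; rw [pow_zero, Matrix.one_apply]; split_ifs <;> norm_num
  | succ k ih => rw [pow_succ]; exact mul_apply_nonneg ih hA

/-- A nonnegative matrix with positive diagonal and strongly connected graph is primitive: thanks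
to the loops, an entry of a power stays positive in all later powers. -/
lemma exists_pow_apply_pos [DecidableEq ι] {A : Matrix ι ι ℝ} (hA : ∀ i j, 0 ≤ A i j)
    (hdiag : ∀ i, 0 < A i i) (hconn : ∀ i j, Relation.ReflTransGen (fun i j => 0 < A i j) i j) :
    ∃ N, 0 < N ∧ ∀ i j, 0 < (A ^ N) i j := by
  have hstay : ∀ i j k l, k ≤ l → 0 < (A ^ k) i j → 0 < (A ^ l) i j := by
    intro i j k l hkl hk
    induction l, hkl using Nat.le_induction with
    | base => exact hk
    | succ l _ ih =>
      rw [pow_succ]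
      exact mul_apply_pos (pow_apply_nonneg hA l) hA j ih (hdiag j)
  have hex : ∀ i j, ∃ k, 0 < (A ^ k) i j := by
    intro i j
    induction hconn i j with
    | refl => exact ⟨0, by simp⟩
    | tail _ hstep ih =>
      obtain ⟨k, hk⟩ := ih
      refine ⟨k + 1, ?_⟩
      rw [pow_succ]
      exact mul_apply_pos (pow_apply_nonneg hA k) hA _ hk hstep
  choose K hK using hex
  refine ⟨(∑ i, ∑ j, K i j) + 1, by omega, fun i j => hstay i j (K i j) _ ?_ (hK i j)⟩
  have h1 : K i j ≤ ∑ j, K i j := Finset.single_le_sum (f := K i) (by simp) (Finset.mem_univ j)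
  have h2 : ∑ j, K i j ≤ ∑ i, ∑ j, K i j :=
    Finset.single_le_sum (f := fun i => ∑ j, K i j) (by simp) (Finset.mem_univ i)
  omega

end Nonnegative

/-! ### Contraction of ratios under positive matrices -/

section Ratios

variable {ι : Type*} [Fintype ι]

/-- A matrix with entries in `[ε, E]` pulls an upper bound `b` of the ratios `h i / s i` towards
the mean ratio `m = (∑ h) / (∑ s)` by the fraction `ε / E`, because it puts at least the fraction
`ε / E` of the weight of each new ratio on `m`. -/
lemma mulVec_le_of_ratio_le [Nonempty ι] {ε E : ℝ} (hε : 0 < ε) {B : Matrix ι ι ℝ}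
    (hB : ∀ i j, ε ≤ B i j ∧ B i j ≤ E) {h s : ι → ℝ} (hs : ∀ i, 0 < s i) {b : ℝ}
    (hb : ∀ i, h i ≤ b * s i) (i : ι) :
    B.mulVec h i ≤ (b - ε / E * (b - (∑ j, h j) / ∑ j, s j)) * B.mulVec s i := by
  have hE : 0 < E := by
    obtain ⟨j⟩ := ‹Nonempty ι›
    exact hε.trans_le ((hB j j).1.trans (hB j j).2)
  have hS : 0 < ∑ j, s j := Finset.sum_pos (fun j _ => hs j) Finset.univ_nonempty
  have h1 : ε * ∑ j, (b * s j - h j) ≤ ∑ j, B i j * (b * s j - h j) := by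
    rw [Finset.mul_sum]
    exact Finset.sum_le_sum fun j _ =>
      mul_le_mul_of_nonneg_right (hB i j).1 (sub_nonneg.2 (hb j))
  have h2 : ∑ j, B i j * (b * s j - h j) = b * B.mulVec s i - B.mulVec h i := by
    simp only [Matrix.mulVec, dotProduct, Finset.mul_sum, ← Finset.sum_sub_distrib]
    exact Finset.sum_congr rfl fun j _ => by ring
  have h3 : B.mulVec s i ≤ E * ∑ j, s j := by
    simp only [Matrix.mulVec, dotProduct, Finset.mul_sum]
    exact Finset.sum_le_sum fun j _ => mul_le_mul_of_nonneg_right (hB i j).2 (hs j).le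
  have h4 : ∑ j, (b * s j - h j) = (b - (∑ j, h j) / ∑ j, s j) * ∑ j, s j := by
    rw [Finset.sum_sub_distrib, ← Finset.mul_sum]; field_simp
  have h5 : 0 ≤ b - (∑ j, h j) / ∑ j, s j := by
    rw [sub_nonneg, div_le_iff₀ hS, Finset.mul_sum]
    exact Finset.sum_le_sum fun j _ => hb j
  have h6 : ε / E * (b - (∑ j, h j) / ∑ j, s j) * B.mulVec s i ≤
      ε / E * (b - (∑ j, h j) / ∑ j, s j) * (E * ∑ j, s j) :=
    mul_le_mul_of_nonneg_left h3 (by positivity)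
  have h7 : ε / E * (b - (∑ j, h j) / ∑ j, s j) * (E * ∑ j, s j) =
      ε * ((b - (∑ j, h j) / ∑ j, s j) * ∑ j, s j) := by field_simp
  rw [h4, h2] at h1
  linarith

lemma le_mulVec_of_le_ratio [Nonempty ι] {ε E : ℝ} (hε : 0 < ε) {B : Matrix ι ι ℝ}
    (hB : ∀ i j, ε ≤ B i j ∧ B i j ≤ E) {h s : ι → ℝ} (hs : ∀ i, 0 < s i) {a : ℝ}
    (ha : ∀ i, a * s i ≤ h i) (i : ι) :
    (a + ε / E * ((∑ j, h j) / (∑ j, s j) - a)) * B.mulVec s i ≤ B.mulVec h i := by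
  have := mulVec_le_of_ratio_le hε hB (h := -h) hs (b := -a)
    (fun i => by simpa using ha i) i
  simp only [Matrix.mulVec_neg, Pi.neg_apply, Finset.sum_neg_distrib, neg_div] at this
  linarith

/-- A nonincreasing sequence that shrinks by the factor `r` every `N` steps decays geometrically,
with ratio `r ^ (1 / N)`. -/
lemma exists_geometric_bound {N : ℕ} (hN : 0 < N) {r : ℝ} (hr : 0 < r) (hr1 : r < 1) :
    ∃ ρ : ℝ, 0 < ρ ∧ ρ < 1 ∧ ∀ u : ℕ → ℝ, Antitone u → u 0 ≤ 1 →
      (∀ k, u (k + N) ≤ r * u k) → ∀ k, u k ≤ r⁻¹ * ρ ^ k := by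
  have hN' : (N : ℝ) ≠ 0 := by positivity
  have hρN : (r ^ ((N : ℝ)⁻¹)) ^ N = r := by
    rw [← Real.rpow_natCast, ← Real.rpow_mul hr.le, inv_mul_cancel₀ hN', Real.rpow_one]
  have hρ0 : 0 < r ^ ((N : ℝ)⁻¹) := Real.rpow_pos_of_pos hr _
  have hρ1 : r ^ ((N : ℝ)⁻¹) < 1 := Real.rpow_lt_one hr.le hr1 (by positivity)
  refine ⟨r ^ ((N : ℝ)⁻¹), hρ0, hρ1, fun u hu hu0 hstep k => ?_⟩
  set ρ := r ^ ((N : ℝ)⁻¹)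
  have hblock : ∀ q, u (N * q) ≤ r ^ q := by
    intro q
    induction q with
    | zero => simpa using hu0
    | succ q ih =>
      rw [mul_add, mul_one, pow_succ']
      exact (hstep _).trans (mul_le_mul_of_nonneg_left ih hr.le)
  have hk : N * (k / N) + k % N = k := Nat.div_add_mod k N
  have hmod : r ≤ ρ ^ (k % N) := by
    rw [← hρN]
    exact pow_le_pow_of_le_one hρ0.le hρ1.le (Nat.mod_lt k hN).le
  calc u k ≤ u (N * (k / N)) := hu (Nat.mul_div_le k N)
    _ ≤ r ^ (k / N) := hblock _
    _ = r⁻¹ * (r ^ (k / N) * r) := by field_simp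
    _ ≤ r⁻¹ * (r ^ (k / N) * ρ ^ (k % N)) := by gcongr
    _ = r⁻¹ * ρ ^ k := by
      conv_rhs => rw [← hk, pow_add, pow_mul, hρN]

/-- The interval spanned by the ratios `h k i / s k i` is nested in `k` and shrinks by the factor
`1 - ε / E` every `N` steps. Hence the ratios have a common limit, and the rate of convergence
depends on `N`, `ε` and `E` only. -/
lemma exists_ratio_limit [Nonempty ι] {N : ℕ} (hN : 0 < N) {ε E : ℝ} (hε : 0 < ε) (hεE : ε < E) :
    ∃ C ρ : ℝ, 0 < ρ ∧ ρ < 1 ∧ ∀ (h s : ℕ → ι → ℝ) (M B : ℕ → Matrix ι ι ℝ),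
      (∀ k i, 0 < s k i) → (∀ i, 0 ≤ h 0 i) → (∀ i, h 0 i ≤ s 0 i) →
      (∀ k i j, 0 ≤ M k i j) → (∀ k, h (k + 1) = (M k).mulVec (h k)) →
      (∀ k, s (k + 1) = (M k).mulVec (s k)) →
      (∀ k i j, ε ≤ B k i j ∧ B k i j ≤ E) → (∀ k, h (k + N) = (B k).mulVec (h k)) →
      (∀ k, s (k + N) = (B k).mulVec (s k)) →
      ∃ L : ℝ, (∀ k i, |h k i / s k i - L| ≤ C * ρ ^ k) ∧
        ∀ k a, (∀ i, a ≤ h k i / s k i) → a ≤ L := by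
  have hE : 0 < E := hε.trans hεE
  have hr : 0 < 1 - ε / E := by rw [sub_pos, div_lt_one hE]; exact hεE
  have hr1 : 1 - ε / E < 1 := by have := div_pos hε hE; linarith
  obtain ⟨ρ, hρ0, hρ1, hρ⟩ := exists_geometric_bound hN hr hr1
  refine ⟨(1 - ε / E)⁻¹, ρ, hρ0, hρ1, ?_⟩
  intro h s M B hs h0 h0s hM hMh hMs hB hBh hBs
  let f : ℕ → ι → ℝ := fun k i => h k i / s k i
  let hi : ℕ → ℝ := fun k => ⨆ i, f k i
  let lo : ℕ → ℝ := fun k => ⨅ i, f k i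
  have hfhi : ∀ k i, f k i ≤ hi k := fun k i => le_ciSup (Set.finite_range (f k)).bddAbove i
  have hlof : ∀ k i, lo k ≤ f k i := fun k i => ciInf_le (Set.finite_range (f k)).bddBelow i
  have hhi : ∀ k i, h k i ≤ hi k * s k i := fun k i => (div_le_iff₀ (hs k i)).1 (hfhi k i)
  have hlo : ∀ k i, lo k * s k i ≤ h k i := fun k i => (le_div_iff₀ (hs k i)).1 (hlof k i)
  have hlohi : ∀ k, lo k ≤ hi k := fun k =>
    let ⟨i⟩ := ‹Nonempty ι›; (hlof k i).trans (hfhi k i)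
  have hanti : Antitone hi := antitone_nat_of_succ_le fun k => ciSup_le fun i => by
    change h (k + 1) i / s (k + 1) i ≤ hi k
    rw [div_le_iff₀ (hs _ i), hMh, hMs]
    have := mulVec_le_mulVec (hM k) (x := h k) (y := hi k • s k) (hhi k) i
    simpa [Matrix.mulVec_smul] using this
  have hmono : Monotone lo := monotone_nat_of_le_succ fun k => le_ciInf fun i => by
    change lo k ≤ h (k + 1) i / s (k + 1) i
    rw [le_div_iff₀ (hs _ i), hMh, hMs]
    have := mulVec_le_mulVec (hM k) (x := lo k • s k) (y := h k) (hlo k) i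
    simpa [Matrix.mulVec_smul] using this
  have hdiam : ∀ k, hi k - lo k ≤ (1 - ε / E)⁻¹ * ρ ^ k := by
    refine hρ (fun k => hi k - lo k) (fun k l hkl => sub_le_sub (hanti hkl) (hmono hkl)) ?_ ?_
    · have h1 : hi 0 ≤ 1 := ciSup_le fun i => (div_le_one (hs 0 i)).2 (h0s i)
      have h2 : 0 ≤ lo 0 := le_ciInf fun i => div_nonneg (h0 i) (hs 0 i).le
      change hi 0 - lo 0 ≤ 1
      linarith
    · intro k
      have h1 : hi (k + N) ≤ hi k - ε / E * (hi k - (∑ j, h k j) / ∑ j, s k j) :=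
        ciSup_le fun i => by
          change h (k + N) i / s (k + N) i ≤ _
          rw [div_le_iff₀ (hs _ i), hBh, hBs]
          exact mulVec_le_of_ratio_le hε (hB k) (hs k) (hhi k) i
      have h2 : lo k + ε / E * ((∑ j, h k j) / (∑ j, s k j) - lo k) ≤ lo (k + N) :=
        le_ciInf fun i => by
          change _ ≤ h (k + N) i / s (k + N) i
          rw [le_div_iff₀ (hs _ i), hBh, hBs]
          exact le_mulVec_of_le_ratio hε (hB k) (hs k) (hlo k) i
      change hi (k + N) - lo (k + N) ≤ (1 - ε / E) * (hi k - lo k)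
      linarith
  have hL := hmono.ciSup_mem_iInter_Icc_of_antitone hanti hlohi
  rw [Set.mem_iInter] at hL
  refine ⟨⨆ k, lo k, fun k i => ?_, fun k a ha => (le_ciInf ha).trans (hL k).1⟩
  have := hdiam k
  have h1 := (hL k).1
  have h2 := (hL k).2
  have h3 := hfhi k i
  have h4 := hlof k i
  change |f k i - _| ≤ _
  rw [abs_le]
  constructor <;> linarith

end Ratios

/-! ### Directions and linear convergence -/

section Directions

variable {m d : ℕ}

lemma norm_dir {x : EuclideanSpace ℝ (Fin d)} (hx : x ≠ 0) : ‖dir x‖ = 1 := by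
  rw [dir, norm_smul, norm_inv, norm_norm, inv_mul_cancel₀ (norm_ne_zero_iff.2 hx)]

lemma dir_smul {x : EuclideanSpace ℝ (Fin d)} {c : ℝ} (hc : 0 < c) : dir (c • x) = dir x := by
  unfold dir
  rw [norm_smul, Real.norm_of_nonneg hc.le, smul_smul, mul_inv, mul_right_comm,
    inv_mul_cancel₀ hc.ne', one_mul]

lemma dir_of_norm_eq_one {x : EuclideanSpace ℝ (Fin d)} (hx : ‖x‖ = 1) : dir x = x := by
  rw [dir, hx, inv_one, one_smul]

lemma norm_smul_dir (x : EuclideanSpace ℝ (Fin d)) : ‖x‖ • dir x = x := by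
  by_cases hx : x = 0
  · simp [hx]
  · rw [dir, smul_smul, mul_inv_cancel₀ (norm_ne_zero_iff.2 hx), one_smul]

lemma continuousAt_dir {x : EuclideanSpace ℝ (Fin d)} (hx : x ≠ 0) : ContinuousAt dir x :=
  (continuous_norm.continuousAt.inv₀ (norm_ne_zero_iff.2 hx)).smul continuousAt_id

/-- No assumption on `x` is needed: the junk value `dir 0 = 0` satisfies the bound as well. -/
lemma norm_dir_sub_dir_le (x : EuclideanSpace ℝ (Fin d)) {y : EuclideanSpace ℝ (Fin d)}
    (hy : y ≠ 0) : ‖dir x - dir y‖ ≤ 2 * ‖y‖⁻¹ * ‖x - y‖ := by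
  have hy' : 0 < ‖y‖ := norm_pos_iff.2 hy
  have h : dir x - dir y = ‖y‖⁻¹ • (x - y) + (‖x‖⁻¹ - ‖y‖⁻¹) • x := by
    unfold dir
    module
  have h2 : ‖(‖x‖⁻¹ - ‖y‖⁻¹) • x‖ ≤ ‖y‖⁻¹ * ‖x - y‖ := by
    by_cases hx : x = 0
    · simp only [hx, smul_zero, norm_zero]
      positivity
    have hx' : 0 < ‖x‖ := norm_pos_iff.2 hx
    rw [norm_smul, Real.norm_eq_abs, ← abs_of_pos hx', ← abs_mul]
    rw [abs_of_pos hx']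
    have : (‖x‖⁻¹ - ‖y‖⁻¹) * ‖x‖ = ‖y‖⁻¹ * (‖y‖ - ‖x‖) := by field_simp
    rw [this, abs_mul, abs_of_pos (inv_pos.2 hy'), norm_sub_rev x y]
    exact mul_le_mul_of_nonneg_left (abs_norm_sub_norm_le y x) (inv_pos.2 hy').le
  calc ‖dir x - dir y‖ ≤ ‖‖y‖⁻¹ • (x - y)‖ + ‖(‖x‖⁻¹ - ‖y‖⁻¹) • x‖ := h ▸ norm_add_le _ _
    _ ≤ ‖y‖⁻¹ * ‖x - y‖ + ‖y‖⁻¹ * ‖x - y‖ := by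
      gcongr
      rw [norm_smul, norm_inv, norm_norm]
    _ = _ := by ring

lemma norm_le_sum_abs (x : EuclideanSpace ℝ (Fin d)) : ‖x‖ ≤ ∑ c, |x c| := by
  conv_lhs => rw [← (EuclideanSpace.basisFun (Fin d) ℝ).sum_repr x]
  refine (norm_sum_le _ _).trans (Finset.sum_le_sum fun c _ => ?_)
  simp [norm_smul]

/-- `O(ρ ^ k)` with `ρ < 1` gives linear convergence: as `ρ ^ k ≠ 0`, the finitely many early terms
only change the constant. -/
lemma ConvergesLinearly.of_isBigO {x : ℕ → EuclideanSpace ℝ (Fin m)}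
    {l : EuclideanSpace ℝ (Fin m)} (h : ConvergesLinearly x l)
    {y : ℕ → EuclideanSpace ℝ (Fin d)} {z : EuclideanSpace ℝ (Fin d)}
    (hO : (fun k => y k - z) =O[atTop] fun k => x k - l) : ConvergesLinearly y z := by
  obtain ⟨C, ρ, h0, h1, hC⟩ := h
  have hx : (fun k => x k - l) =O[atTop] fun k => ρ ^ k :=
    Asymptotics.IsBigO.of_bound C (Eventually.of_forall fun k => by
      rw [Real.norm_of_nonneg (pow_pos h0 k).le]; exact hC k)
  obtain ⟨C', _, hC'⟩ := Asymptotics.bound_of_isBigO_nat_atTop (hO.trans hx)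
  refine ⟨C', ρ, h0, h1, fun k => ?_⟩
  have := hC' (x := k) (pow_pos h0 k).ne'
  rwa [Real.norm_of_nonneg (pow_pos h0 k).le] at this

lemma ConvergesLinearly.tendsto {x : ℕ → EuclideanSpace ℝ (Fin d)}
    {l : EuclideanSpace ℝ (Fin d)} (h : ConvergesLinearly x l) : Tendsto x atTop (𝓝 l) := by
  obtain ⟨C, ρ, h0, h1, hC⟩ := h
  rw [tendsto_iff_norm_sub_tendsto_zero]
  refine squeeze_zero (fun _ => norm_nonneg _) hC ?_
  simpa using (tendsto_pow_atTop_nhds_zero_of_lt_one h0.le h1).const_mul C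

lemma ConvergesLinearly.dir {x : ℕ → EuclideanSpace ℝ (Fin d)}
    {l : EuclideanSpace ℝ (Fin d)} (h : ConvergesLinearly x l) (hl : l ≠ 0) :
    ConvergesLinearly (fun k => dir (x k)) (dir l) :=
  h.of_isBigO (Asymptotics.IsBigO.of_bound (2 * ‖l‖⁻¹)
    (Eventually.of_forall fun k => norm_dir_sub_dir_le (x k) hl))

/-- Right multiplication of row vectors by a matrix, as a continuous linear map. -/
noncomputable def rowMulL (X : Matrix (Fin m) (Fin d) ℝ) :
    EuclideanSpace ℝ (Fin m) →L[ℝ] EuclideanSpace ℝ (Fin d) :=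
  LinearMap.toContinuousLinearMap
    { toFun := fun w => rowMul w X
      map_add' := fun w w' => by simp [rowMul, Matrix.add_vecMul]
      map_smul' := fun c w => by simp [rowMul, Matrix.smul_vecMul] }

lemma rowMulL_apply (X : Matrix (Fin m) (Fin d) ℝ) (w : EuclideanSpace ℝ (Fin m)) :
    rowMulL X w = rowMul w X := rfl

lemma ConvergesLinearly.rowMul {x : ℕ → EuclideanSpace ℝ (Fin m)}
    {l : EuclideanSpace ℝ (Fin m)} (h : ConvergesLinearly x l) (X : Matrix (Fin m) (Fin d) ℝ) :
    ConvergesLinearly (fun k => rowMul (x k) X) (rowMul l X) :=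
  h.of_isBigO <| by
    simp only [← rowMulL_apply, ← map_sub]
    exact (rowMulL X).isBigO_comp _ _

lemma rowMul_smul (c : ℝ) (w : EuclideanSpace ℝ (Fin m)) (X : Matrix (Fin m) (Fin d) ℝ) :
    rowMul (c • w) X = c • rowMul w X := (rowMulL X).map_smul c w

lemma rowMul_eq_sum (w : EuclideanSpace ℝ (Fin m)) (X : Matrix (Fin m) (Fin d) ℝ) :
    rowMul w X = ∑ i, w i • row X i := by
  ext c
  simp [rowMul, row, Matrix.vecMul, dotProduct]

lemma rowMul_mul {l : ℕ} (w : EuclideanSpace ℝ (Fin m)) (X : Matrix (Fin m) (Fin d) ℝ)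
    (Y : Matrix (Fin d) (Fin l) ℝ) : rowMul w (X * Y) = rowMul (rowMul w X) Y := by
  simp [rowMul, Matrix.vecMul_vecMul]

lemma row_mul {l : ℕ} (X : Matrix (Fin m) (Fin d) ℝ) (Y : Matrix (Fin d) (Fin l) ℝ) (i : Fin m) :
    row (X * Y) i = rowMul (row X i) Y := by
  ext c
  simp [rowMul, row, Matrix.mul_apply, Matrix.vecMul, dotProduct]

/-- The direction of a row of a product depends only on the direction of the row of the left
factor. -/
lemma dir_row_mul {l : ℕ} (X : Matrix (Fin m) (Fin d) ℝ) (Y : Matrix (Fin d) (Fin l) ℝ)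
    (i : Fin m) : dir (row (X * Y) i) = dir (rowMul (dir (row X i)) Y) := by
  rw [row_mul]
  by_cases hX : row X i = 0
  · simp [hX, dir]
  · conv_lhs => rw [← norm_smul_dir (row X i), rowMul_smul, dir_smul (norm_pos_iff.2 hX)]

end Directions

/-! ### The limit direction of the rows of a matrix cocycle -/

section Cocycle

variable {S : Type*} {n : ℕ}

/-- The products `M (F^[k-1] x) ⋯ M (F x) M x` of a matrix-valued function along the orbit of
`x`. -/
def cocycle (F : S → S) (M : S → Matrix (Fin n) (Fin n) ℝ) (x : S) :
    ℕ → Matrix (Fin n) (Fin n) ℝ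
  | 0 => 1
  | k + 1 => M (F^[k] x) * cocycle F M x k

variable {F : S → S} {M : S → Matrix (Fin n) (Fin n) ℝ} {A : Matrix (Fin n) (Fin n) ℝ} {δ Δ : ℝ}

lemma cocycle_add (x : S) (k l : ℕ) :
    cocycle F M x (k + l) = cocycle F M (F^[k] x) l * cocycle F M x k := by
  induction l with
  | zero => simp [cocycle]
  | succ l ih =>
    rw [← add_assoc, cocycle, cocycle, ih, Matrix.mul_assoc, ← Function.iterate_add_apply,
      add_comm l k]

lemma cocycle_bounds (hA : ∀ i j, 0 ≤ A i j) (hδ : 0 ≤ δ)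
    (hM : ∀ x i j, δ * A i j ≤ M x i j ∧ M x i j ≤ Δ * A i j) (x : S) (k : ℕ) (i j : Fin n) :
    δ ^ k * (A ^ k) i j ≤ cocycle F M x k i j ∧ cocycle F M x k i j ≤ Δ ^ k * (A ^ k) i j := by
  have hM0 : ∀ x i j, 0 ≤ M x i j := fun x i j => (mul_nonneg hδ (hA i j)).trans (hM x i j).1
  induction k generalizing i j with
  | zero => simp [cocycle]
  | succ k ih =>
    have hk := pow_apply_nonneg hA k
    have hc : ∀ i j, 0 ≤ cocycle F M x k i j := fun i j =>
      (mul_nonneg (pow_nonneg hδ k) (hk i j)).trans (ih i j).1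
    have e : ∀ c : ℝ, c ^ (k + 1) * (A ^ (k + 1)) i j = ((c • A) * (c ^ k • A ^ k)) i j := by
      intro c
      rw [Matrix.smul_mul, Matrix.mul_smul, smul_smul, ← pow_succ', ← pow_succ', Matrix.smul_apply,
        smul_eq_mul]
    rw [e, e, cocycle]
    exact ⟨mul_apply_mono (fun i j => mul_nonneg hδ (hA i j))
        (fun i j => mul_nonneg (pow_nonneg hδ k) (hk i j)) (fun i j => (hM _ i j).1)
        (fun i j => (ih i j).1) i j,
      mul_apply_mono (hM0 _) hc (fun i j => (hM _ i j).2) (fun i j => (ih i j).2) i j⟩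

lemma continuous_cocycle [TopologicalSpace S] (hF : Continuous F) (hM : Continuous M) (k : ℕ) :
    Continuous fun x => cocycle F M x k := by
  induction k with
  | zero => exact continuous_const
  | succ k ih => exact (hM.comp (hF.iterate k)).matrix_mul ih

/-- The rows of a cocycle that is comparable with the powers of a primitive matrix have a common
limit direction. It is continuous in the initial point because the rate of convergence is
uniform. -/
theorem exists_limit_direction [TopologicalSpace S] (hn : 0 < n) (hF : Continuous F)
    (hM : Continuous M) (hA : ∀ i j, 0 ≤ A i j) (hdiag : ∀ i, 0 < A i i)
    {N : ℕ} (hN : 0 < N) (hAN : ∀ i j, 0 < (A ^ N) i j) (hδ : 0 < δ)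
    (hMA : ∀ x i j, δ * A i j ≤ M x i j ∧ M x i j ≤ Δ * A i j) :
    ∃ v : S → EuclideanSpace ℝ (Fin n), Continuous v ∧ (∀ x, ‖v x‖ = 1 ∧ ∀ i, 0 < v x i) ∧
      ∀ x i, ConvergesLinearly (fun k => dir (row (cocycle F M x k) i)) (v x) := by
  have : Nonempty (Fin n) := ⟨⟨0, hn⟩⟩
  have hM0 : ∀ x i j, 0 ≤ M x i j := fun x i j =>
    (mul_nonneg hδ.le (hA i j)).trans (hMA x i j).1
  have hT0 : ∀ x k i j, 0 ≤ cocycle F M x k i j := fun x k i j =>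
    (mul_nonneg (pow_nonneg hδ.le k) (pow_apply_nonneg hA k i j)).trans
      (cocycle_bounds hA hδ.le hMA x k i j).1
  obtain ⟨⟨i₁, j₁⟩, hmin⟩ := Finite.exists_min fun q : Fin n × Fin n => (A ^ N) q.1 q.2
  obtain ⟨⟨i₂, j₂⟩, hmax⟩ := Finite.exists_max fun q : Fin n × Fin n => Δ ^ N * (A ^ N) q.1 q.2
  set ε := δ ^ N * (A ^ N) i₁ j₁
  have hε : 0 < ε := mul_pos (pow_pos hδ N) (hAN _ _)
  -- The summand `1` makes `ε < E` strict.
  set E := Δ ^ N * (A ^ N) i₂ j₂ + 1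
  have hB : ∀ x i j, ε ≤ cocycle F M x N i j ∧ cocycle F M x N i j ≤ E := fun x i j =>
    ⟨(mul_le_mul_of_nonneg_left (hmin (i, j)) (pow_pos hδ N).le).trans
        (cocycle_bounds hA hδ.le hMA x N i j).1,
      ((cocycle_bounds hA hδ.le hMA x N i j).2.trans (hmax (i, j))).trans (by simp [E])⟩
  have hs : ∀ x k i, 0 < ((cocycle F M x k).mulVec 1) i := by
    intro x k i
    induction k generalizing i with
    | zero => simp [cocycle]
    | succ k ih =>
      rw [cocycle, ← Matrix.mulVec_mulVec]
      exact Finset.sum_pos' (fun j _ => mul_nonneg (hM0 _ i j) (ih j).le)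
        ⟨i, Finset.mem_univ _, mul_pos ((mul_pos hδ (hdiag i)).trans_le (hMA _ i i).1) (ih i)⟩
  by_cases hSe : IsEmpty S
  · exact ⟨fun _ => 0, continuous_const, fun x => hSe.elim x, fun x => hSe.elim x⟩
  have hεE : ε < E := by
    obtain ⟨x⟩ := not_isEmpty_iff.1 hSe
    have h1 := (cocycle_bounds hA hδ.le hMA (F := F) x N i₁ j₁)
    have h2 := hmax (i₁, j₁)
    have h3 := h1.1.trans h1.2
    simp only [E, ε]
    linarith
  obtain ⟨C, ρ, hρ0, hρ1, hlim⟩ := exists_ratio_limit (ι := Fin n) hN hε hεE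
  have hp : ∀ x c, ∃ L : ℝ,
      (∀ k i, |cocycle F M x k i c / ((cocycle F M x k).mulVec 1) i - L| ≤ C * ρ ^ k) ∧
      ∀ k a, (∀ i, a ≤ cocycle F M x k i c / ((cocycle F M x k).mulVec 1) i) → a ≤ L := by
    intro x c
    -- The ratios compare the column `c`, the image of a standard basis vector, with the row sums.
    have hcol : ∀ k i, cocycle F M x k i c = (cocycle F M x k).mulVec (Pi.single c 1) i := by
      intro k i
      simp
    simp only [hcol]
    refine hlim (fun k => (cocycle F M x k).mulVec (Pi.single c 1))
      (fun k => (cocycle F M x k).mulVec 1) (fun k => M (F^[k] x))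
      (fun k => cocycle F M (F^[k] x) N) (hs x) ?_ ?_ (fun k => hM0 _) ?_ ?_ (fun k => hB _) ?_ ?_
    · intro i
      rw [← hcol]
      exact hT0 _ _ _ _
    · intro i
      refine mulVec_le_mulVec (hT0 x 0) (fun j => ?_) i
      rw [Pi.single_apply]
      split_ifs <;> simp
    all_goals
      intro k
      simp only [cocycle_add, cocycle, Matrix.mulVec_mulVec]
  choose p hp1 hp2 using hp
  have hpos : ∀ x c, 0 < p x c := by
    intro x c
    obtain ⟨i, hi⟩ := Finite.exists_min fun i =>
      cocycle F M x N i c / ((cocycle F M x N).mulVec 1) i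
    exact (div_pos (hε.trans_le (hB x i c).1) (hs x N i)).trans_le (hp2 x c N _ hi)
  have hne : ∀ x, WithLp.toLp 2 (p x) ≠ 0 := fun x h => by
    have := congrArg (fun z : EuclideanSpace ℝ (Fin n) => z ⟨0, hn⟩) h
    exact (hpos x ⟨0, hn⟩).ne' (by simpa using this)
  have hpcont : ∀ c, Continuous fun x => p x c := by
    intro c
    let i : Fin n := ⟨0, hn⟩
    have hU : TendstoUniformly
        (fun k x => cocycle F M x k i c / ((cocycle F M x k).mulVec 1) i)
        (fun x => p x c) atTop := by
      rw [Metric.tendstoUniformly_iff]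
      intro η hη
      have h0 : Tendsto (fun k => C * ρ ^ k) atTop (𝓝 0) := by
        simpa using (tendsto_pow_atTop_nhds_zero_of_lt_one hρ0.le hρ1).const_mul C
      filter_upwards [h0.eventually_lt_const hη] with k hk x
      rw [dist_comm, Real.dist_eq]
      exact (hp1 x c k i).trans_lt hk
    refine hU.continuous (Frequently.of_forall fun k => ?_)
    have hT := continuous_cocycle hF hM k
    refine (hT.matrix_elem i c).div ?_ fun x => (hs x k i).ne'
    exact (continuous_apply i).comp (hT.matrix_mulVec continuous_const)
  refine ⟨fun x => dir (WithLp.toLp 2 (p x)), ?_, fun x => ⟨norm_dir (hne x), fun i => ?_⟩,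
    fun x i => ?_⟩
  · exact continuous_iff_continuousAt.2 fun x => (continuousAt_dir (hne x)).comp
      (f := fun x => WithLp.toLp 2 (p x))
      ((PiLp.continuous_toLp 2 _).comp (continuous_pi hpcont)).continuousAt
  · exact mul_pos (inv_pos.2 (norm_pos_iff.2 (hne x))) (hpos x i)
  · have hconv : ConvergesLinearly
        (fun k => (((cocycle F M x k).mulVec 1) i)⁻¹ • row (cocycle F M x k) i)
        (WithLp.toLp 2 (p x)) := by
      refine ⟨n * C, ρ, hρ0, hρ1, fun k => (norm_le_sum_abs _).trans ?_⟩
      calc _ ≤ ∑ _c : Fin n, C * ρ ^ k := Finset.sum_le_sum fun c _ => by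
              have := hp1 x c k i
              rwa [div_eq_inv_mul] at this
        _ = n * C * ρ ^ k := by simp [mul_assoc]
    have := hconv.dir (hne x)
    simpa only [dir_smul (inv_pos.2 (hs x _ i))] using this

end Cocycle

/-! ### Trajectories -/

section Trajectories

variable {n d : ℕ} {γ : Fin n → EuclideanSpace ℝ (Fin d) → ℝ} {A : Matrix (Fin n) (Fin n) ℝ}

lemma sphereMin_le {g : EuclideanSpace ℝ (Fin d) → ℝ} (hg : IsDirectional g)
    {x : EuclideanSpace ℝ (Fin d)} (hx : x ∈ sphere 0 1) : sphereMin g ≤ g x := by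
  obtain ⟨_, c, C, _, h⟩ := hg
  exact csInf_le ⟨c, by rintro _ ⟨y, hy, rfl⟩; exact (h y hy).1⟩ ⟨x, hx, rfl⟩

lemma le_sphereMax {g : EuclideanSpace ℝ (Fin d) → ℝ} (hg : IsDirectional g)
    {x : EuclideanSpace ℝ (Fin d)} (hx : x ∈ sphere 0 1) : g x ≤ sphereMax g := by
  obtain ⟨_, c, C, _, h⟩ := hg
  exact le_csSup ⟨C, by rintro _ ⟨y, hy, rfl⟩; exact (h y hy).2⟩ ⟨x, hx, rfl⟩

lemma IsDirectional.pos {g : EuclideanSpace ℝ (Fin d) → ℝ} (hg : IsDirectional g)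
    {x : EuclideanSpace ℝ (Fin d)} (hx : x ∈ sphere 0 1) : 0 < g x := by
  obtain ⟨_, c, C, hc, h⟩ := hg
  exact hc.trans_le (h x hx).1

/-- For `d = 0` the sphere is empty, and the infimum has the junk value `0`. -/
lemma sphereMin_nonneg {g : EuclideanSpace ℝ (Fin d) → ℝ} (hg : IsDirectional g) :
    0 ≤ sphereMin g :=
  Real.sInf_nonneg (by rintro _ ⟨y, hy, rfl⟩; exact (hg.pos hy).le)

lemma sphereMax_nonneg {g : EuclideanSpace ℝ (Fin d) → ℝ} (hg : IsDirectional g) :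
    0 ≤ sphereMax g :=
  Real.sSup_nonneg (by rintro _ ⟨y, hy, rfl⟩; exact (hg.pos hy).le)

lemma dir_mem_sphere {x : EuclideanSpace ℝ (Fin d)} (hx : x ≠ 0) :
    dir x ∈ sphere (0 : EuclideanSpace ℝ (Fin d)) 1 := by
  simpa using norm_dir hx

lemma norm_row_mem_Icc (hγ : ∀ i, IsDirectional (γ i)) {X : Matrix (Fin n) (Fin d) ℝ}
    (hX : X ∈ stateSpace γ) (i : Fin n) :
    ‖row X i‖ ∈ Set.Icc (sphereMin (γ i)) (sphereMax (γ i)) := by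
  obtain ⟨x, hx, h⟩ := hX i
  have : ‖row X i‖ = γ i x := by
    rw [h, norm_smul, mem_sphere_zero_iff_norm.1 hx, mul_one,
      Real.norm_of_nonneg ((hγ i).pos hx).le]
  rw [this]
  exact ⟨sphereMin_le (hγ i) hx, le_sphereMax (hγ i) hx⟩

lemma row_ne_zero (hγ : ∀ i, IsDirectional (γ i)) {X : Matrix (Fin n) (Fin d) ℝ}
    (hX : X ∈ stateSpace γ) (i : Fin n) : row X i ≠ 0 := by
  obtain ⟨x, hx, h⟩ := hX i
  rw [h]
  exact smul_ne_zero ((hγ i).pos hx).ne' (ne_zero_of_mem_unit_sphere ⟨x, hx⟩)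

lemma row_eq_radialProj (hγ : ∀ i, IsDirectional (γ i)) {X : Matrix (Fin n) (Fin d) ℝ}
    (hX : X ∈ stateSpace γ) (i : Fin n) : row X i = radialProj (γ i) (row X i) := by
  obtain ⟨x, hx, h⟩ := hX i
  rw [radialProj, h, dir_smul ((hγ i).pos hx), dir_of_norm_eq_one (mem_sphere_zero_iff_norm.1 hx)]

lemma diag_pos (hA : ∀ i j, 0 ≤ A i j) (hγ : ∀ i, IsDirectional (γ i))
    (hdom : DominanceCondition A γ) (i : Fin n) : 0 < A i i := by
  refine pos_of_mul_pos_left (lt_of_le_of_lt ?_ (hdom i)) (sphereMin_nonneg (hγ i))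
  exact Finset.sum_nonneg fun j _ => mul_nonneg (hA i j) (sphereMax_nonneg (hγ j))

lemma row_mul_eq_sum (X : Matrix (Fin n) (Fin d) ℝ) (i : Fin n) :
    row (A * X) i = ∑ j, A i j • row X j := by
  rw [row_mul, rowMul_eq_sum]
  rfl

lemma norm_row_mul_le (hA : ∀ i j, 0 ≤ A i j) (hγ : ∀ i, IsDirectional (γ i))
    {X : Matrix (Fin n) (Fin d) ℝ} (hX : X ∈ stateSpace γ) (i : Fin n) :
    ‖row (A * X) i‖ ≤ ∑ j, A i j * sphereMax (γ j) := by
  rw [row_mul_eq_sum]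
  refine norm_sum_le_of_le _ fun j _ => ?_
  rw [norm_smul, Real.norm_of_nonneg (hA i j)]
  exact mul_le_mul_of_nonneg_left (norm_row_mem_Icc hγ hX j).2 (hA i j)

/-- By diagonal dominance, the neighbours cannot cancel the contribution of the agent itself. -/
lemma le_norm_row_mul (hA : ∀ i j, 0 ≤ A i j) (hγ : ∀ i, IsDirectional (γ i))
    {X : Matrix (Fin n) (Fin d) ℝ} (hX : X ∈ stateSpace γ) (i : Fin n) :
    A i i * sphereMin (γ i) - ∑ j ∈ Finset.univ.erase i, A i j * sphereMax (γ j) ≤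
      ‖row (A * X) i‖ := by
  rw [row_mul_eq_sum, ← Finset.add_sum_erase _ _ (Finset.mem_univ i)]
  have h1 : ‖∑ j ∈ Finset.univ.erase i, A i j • row X j‖ ≤
      ∑ j ∈ Finset.univ.erase i, A i j * sphereMax (γ j) := by
    refine norm_sum_le_of_le _ fun j _ => ?_
    rw [norm_smul, Real.norm_of_nonneg (hA i j)]
    exact mul_le_mul_of_nonneg_left (norm_row_mem_Icc hγ hX j).2 (hA i j)
  have h2 : A i i * sphereMin (γ i) ≤ ‖A i i • row X i‖ := by
    rw [norm_smul, Real.norm_of_nonneg (hA i i)]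
    exact mul_le_mul_of_nonneg_left (norm_row_mem_Icc hγ hX i).1 (hA i i)
  have h3 := norm_sub_le_norm_add (A i i • row X i) (∑ j ∈ Finset.univ.erase i, A i j • row X j)
  linarith

lemma row_mul_ne_zero (hA : ∀ i j, 0 ≤ A i j) (hγ : ∀ i, IsDirectional (γ i))
    (hdom : DominanceCondition A γ) {X : Matrix (Fin n) (Fin d) ℝ} (hX : X ∈ stateSpace γ)
    (i : Fin n) : row (A * X) i ≠ 0 :=
  norm_pos_iff.1 ((sub_pos.2 (hdom i)).trans_le (le_norm_row_mul hA hγ hX i))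

/-- The scaling factors along trajectories are bounded, and bounded away from zero. -/
lemma exists_scaling_bounds (hn : 0 < n) (hA : ∀ i j, 0 ≤ A i j)
    (hγ : ∀ i, IsDirectional (γ i)) (hdom : DominanceCondition A γ) :
    ∃ δ Δ : ℝ, 0 < δ ∧ ∀ X ∈ stateSpace γ, ∀ i,
      δ ≤ γ i (dir (row (A * X) i)) / ‖row (A * X) i‖ ∧
      γ i (dir (row (A * X) i)) / ‖row (A * X) i‖ ≤ Δ := by
  have : Nonempty (Fin n) := ⟨⟨0, hn⟩⟩
  have hloc : ∀ i, ∃ δ Δ : ℝ, 0 < δ ∧ ∀ X ∈ stateSpace γ,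
      δ ≤ γ i (dir (row (A * X) i)) / ‖row (A * X) i‖ ∧
      γ i (dir (row (A * X) i)) / ‖row (A * X) i‖ ≤ Δ := by
    intro i
    obtain ⟨_, c, C, hc, hcC⟩ := hγ i
    set U := max 1 (∑ j, A i j * sphereMax (γ j))
    have hU : 0 < U := zero_lt_one.trans_le (le_max_left _ _)
    have hβ := sub_pos.2 (hdom i)
    -- Division by `U ≥ 1` avoids the case in which the bound on the norm is zero.
    refine ⟨c / U, C / (A i i * sphereMin (γ i) -
      ∑ j ∈ Finset.univ.erase i, A i j * sphereMax (γ j)), div_pos hc hU, fun X hX => ?_⟩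
    have h0 := row_mul_ne_zero hA hγ hdom hX i
    have hb := norm_pos_iff.2 h0
    obtain ⟨h1, h2⟩ := hcC _ (dir_mem_sphere h0)
    exact ⟨div_le_div₀ (hc.le.trans h1) h1 hb
        ((norm_row_mul_le hA hγ hX i).trans (le_max_right _ _)),
      div_le_div₀ (hc.le.trans (h1.trans h2)) h2 hβ (le_norm_row_mul hA hγ hX i)⟩
  choose δ Δ hδ h using hloc
  obtain ⟨i, hi⟩ := Finite.exists_min δ
  obtain ⟨j, hj⟩ := Finite.exists_max Δ
  exact ⟨δ i, Δ j, hδ i, fun X hX k => ⟨(hi k).trans (h k X hX).1, (h k X hX).2.trans (hj k)⟩⟩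

lemma proj_eq_scaling_mul (B : Matrix (Fin n) (Fin d) ℝ) : proj γ B = scaling γ B * B := by
  ext i j
  rw [scaling, Matrix.diagonal_mul]
  simp only [proj, radialProj, Matrix.of_apply, dir, PiLp.smul_apply, smul_eq_mul]
  simp only [row]
  ring

lemma proj_mul_mem_stateSpace (hA : ∀ i j, 0 ≤ A i j) (hγ : ∀ i, IsDirectional (γ i))
    (hdom : DominanceCondition A γ) {X : Matrix (Fin n) (Fin d) ℝ} (hX : X ∈ stateSpace γ) :
    proj γ (A * X) ∈ stateSpace γ := fun i =>
  ⟨_, dir_mem_sphere (row_mul_ne_zero hA hγ hdom hX i), rfl⟩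

lemma IsTrajectory.mem_stateSpace (hA : ∀ i j, 0 ≤ A i j) (hγ : ∀ i, IsDirectional (γ i))
    (hdom : DominanceCondition A γ) {t₀ : ℕ} {X : ℕ → Matrix (Fin n) (Fin d) ℝ}
    (hX : IsTrajectory A γ t₀ X) (k : ℕ) : X (t₀ + k) ∈ stateSpace γ := by
  induction k with
  | zero => exact hX.1
  | succ k ih =>
    rw [← add_assoc, hX.2 _ (Nat.le_add_right _ _)]
    exact proj_mul_mem_stateSpace hA hγ hdom ih

lemma IsTrajectory.shift (hA : ∀ i j, 0 ≤ A i j) (hγ : ∀ i, IsDirectional (γ i))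
    (hdom : DominanceCondition A γ) {t₀ : ℕ} {X : ℕ → Matrix (Fin n) (Fin d) ℝ}
    (hX : IsTrajectory A γ t₀ X) (k : ℕ) : IsTrajectory A γ (t₀ + k) X :=
  ⟨hX.mem_stateSpace hA hγ hdom k, fun t ht => hX.2 t ((Nat.le_add_right t₀ k).trans ht)⟩

lemma IsTrajectory.eq_transition_mul {t₀ : ℕ} {X : ℕ → Matrix (Fin n) (Fin d) ℝ}
    (hX : IsTrajectory A γ t₀ X) (k : ℕ) : X (t₀ + k) = transition A γ t₀ X k * X t₀ := by
  induction k with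
  | zero => simp [transition]
  | succ k ih =>
    rw [← add_assoc, hX.2 _ (Nat.le_add_right _ _), proj_eq_scaling_mul, transition,
      Matrix.mul_assoc, Matrix.mul_assoc, ← ih]

lemma transition_add (t₀ : ℕ) (X : ℕ → Matrix (Fin n) (Fin d) ℝ) (k l : ℕ) :
    transition A γ t₀ X (k + l) = transition A γ (t₀ + k) X l * transition A γ t₀ X k := by
  induction l with
  | zero => simp [transition]
  | succ l ih =>
    rw [← add_assoc, transition, transition, ih, Matrix.mul_assoc _ _ (transition _ _ _ _ k),
      add_assoc]

lemma exists_isTrajectory {X₀ : Matrix (Fin n) (Fin d) ℝ} (hX₀ : X₀ ∈ stateSpace γ) :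
    ∃ X, IsTrajectory A γ 0 X ∧ X 0 = X₀ :=
  ⟨fun k => (fun X => proj γ (A * X))^[k] X₀,
    ⟨hX₀, fun _ _ => Function.iterate_succ_apply' _ _ _⟩, rfl⟩

end Trajectories

/-! ### The limit vector -/

section LimitVector

variable {n d : ℕ} {γ : Fin n → EuclideanSpace ℝ (Fin d) → ℝ} {A : Matrix (Fin n) (Fin n) ℝ}

lemma continuous_scaling_mul (hA : ∀ i j, 0 ≤ A i j) (hγ : ∀ i, IsDirectional (γ i))
    (hdom : DominanceCondition A γ) :
    Continuous fun X : stateSpace γ => scaling γ (A * X.1) := by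
  refine Continuous.matrix_diagonal (continuous_pi fun i => ?_)
  have hrow : Continuous fun X : stateSpace γ => row (A * X.1) i :=
    (PiLp.continuous_toLp 2 _).comp
      ((continuous_apply i).comp (continuous_const.matrix_mul continuous_subtype_val))
  have hne : ∀ X : stateSpace γ, row (A * X.1) i ≠ 0 := fun X =>
    row_mul_ne_zero hA hγ hdom X.2 i
  have hdir : Continuous fun X : stateSpace γ => dir (row (A * X.1) i) :=
    continuous_iff_continuousAt.2 fun X =>
      (continuousAt_dir (hne X)).comp (f := fun X : stateSpace γ => row (A * X.1) i)
        hrow.continuousAt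
  exact ((hγ i).1.comp_continuous hdir fun X => dir_mem_sphere (hne X)).div hrow.norm
    fun X => norm_ne_zero_iff.2 (hne X)

theorem exists_isLimitVector (hn : 0 < n) (hA : ∀ i j, 0 ≤ A i j)
    (hconn : ∀ i j, Relation.ReflTransGen (fun i j => 0 < A i j) i j)
    (hγ : ∀ i, IsDirectional (γ i)) (hdom : DominanceCondition A γ) :
    ∃ v, IsLimitVector A γ v := by
  have hdiag := diag_pos hA hγ hdom
  obtain ⟨N, hN, hAN⟩ := exists_pow_apply_pos hA hdiag hconn
  obtain ⟨δ, Δ, hδ, hbd⟩ := exists_scaling_bounds hn hA hγ hdom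
  let F : stateSpace γ → stateSpace γ := fun X =>
    ⟨proj γ (A * X.1), proj_mul_mem_stateSpace hA hγ hdom X.2⟩
  let M : stateSpace γ → Matrix (Fin n) (Fin n) ℝ := fun X => scaling γ (A * X.1) * A
  have hS := continuous_scaling_mul hA hγ hdom
  have hF : Continuous F := by
    refine Continuous.subtype_mk ?_ _
    simp only [proj_eq_scaling_mul]
    exact hS.matrix_mul (continuous_const.matrix_mul continuous_subtype_val)
  have hM : Continuous M := hS.matrix_mul continuous_const
  have hMA : ∀ X i j, δ * A i j ≤ M X i j ∧ M X i j ≤ Δ * A i j := fun X i j => by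
    simp only [M, scaling, Matrix.diagonal_mul]
    exact ⟨mul_le_mul_of_nonneg_right (hbd X.1 X.2 i).1 (hA i j),
      mul_le_mul_of_nonneg_right (hbd X.1 X.2 i).2 (hA i j)⟩
  obtain ⟨v, hvc, hvpos, hv⟩ := exists_limit_direction hn hF hM hA hdiag hN hAN hδ hMA
  refine ⟨v, hvc, hvpos, fun t₀ X hX i => ?_⟩
  have horbit : ∀ k, X (t₀ + k) = (F^[k] ⟨X t₀, hX.1⟩).1 := by
    intro k
    induction k with
    | zero => rfl
    | succ k ih => rw [← add_assoc, hX.2 _ (Nat.le_add_right _ _), Function.iterate_succ_apply', ih]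
  have hT : ∀ k, transition A γ t₀ X k = cocycle F M ⟨X t₀, hX.1⟩ k := by
    intro k
    induction k with
    | zero => rfl
    | succ k ih => rw [transition, cocycle, ih, horbit]
  simpa only [hT] using hv ⟨X t₀, hX.1⟩ i

lemma IsLimitVector.unique (hn : 0 < n) {v w : stateSpace γ → EuclideanSpace ℝ (Fin n)}
    (hv : IsLimitVector A γ v) (hw : IsLimitVector A γ w) : v = w := by
  funext ⟨X₀, hX₀⟩
  obtain ⟨X, hX, rfl⟩ := exists_isTrajectory (A := A) hX₀
  exact tendsto_nhds_unique (hv.2.2 0 X hX ⟨0, hn⟩).tendsto (hw.2.2 0 X hX ⟨0, hn⟩).tendsto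

/-- The limit vector at the initial state is, up to normalization, the limit vector at a later
state multiplied by the transition matrix. -/
lemma IsLimitVector.eq_dir_rowMul (hn : 0 < n) {v : stateSpace γ → EuclideanSpace ℝ (Fin n)}
    (hv : IsLimitVector A γ v) {t₀ k : ℕ} {X : ℕ → Matrix (Fin n) (Fin d) ℝ}
    (hX : IsTrajectory A γ t₀ X) (hXk : IsTrajectory A γ (t₀ + k) X)
    (hne : rowMul (v ⟨X (t₀ + k), hXk.1⟩) (transition A γ t₀ X k) ≠ 0) :
    v ⟨X t₀, hX.1⟩ = dir (rowMul (v ⟨X (t₀ + k), hXk.1⟩) (transition A γ t₀ X k)) := by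
  have h1 := (((hv.2.2 _ X hXk ⟨0, hn⟩).rowMul (transition A γ t₀ X k)).dir hne).tendsto
  have h2 := (tendsto_add_atTop_iff_nat k).2 (hv.2.2 _ X hX ⟨0, hn⟩).tendsto
  refine tendsto_nhds_unique h2 (h1.congr fun l => ?_)
  rw [← dir_row_mul, ← transition_add, add_comm]

/-- If the directions of the rows of a state are close to each other, then the rows lie in an open
half-space, so that no positive combination of them vanishes. -/
lemma rowMul_ne_zero_of_norm_dir_sub_lt (hγ : ∀ i, IsDirectional (γ i))
    {X : Matrix (Fin n) (Fin d) ℝ} (hX : X ∈ stateSpace γ) {i : Fin n}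
    (h : ∀ j, ‖dir (row X j) - dir (row X i)‖ < 1) {w : EuclideanSpace ℝ (Fin n)}
    (hw : ∀ j, 0 < w j) : rowMul w X ≠ 0 := by
  intro h0
  have hpos : ∀ j, 0 < inner ℝ (row X j) (dir (row X i)) := by
    intro j
    have h1 := norm_dir (row_ne_zero hγ hX j)
    have h2 := norm_dir (row_ne_zero hγ hX i)
    have h3 := norm_sub_sq_real (dir (row X j)) (dir (row X i))
    have h4 : ‖dir (row X j) - dir (row X i)‖ ^ 2 < 1 :=
      pow_lt_one₀ (norm_nonneg _) (h j) two_ne_zero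
    rw [h1, h2] at h3
    rw [← norm_smul_dir (row X j), real_inner_smul_left]
    exact mul_pos (norm_pos_iff.2 (row_ne_zero hγ hX j)) (by linarith)
  have hsum : inner ℝ (rowMul w X) (dir (row X i)) =
      ∑ j, w j * inner ℝ (row X j) (dir (row X i)) := by
    rw [rowMul_eq_sum, sum_inner]
    simp only [real_inner_smul_left]
  rw [h0, inner_zero_left] at hsum
  exact (Finset.sum_pos (fun j _ => mul_pos (hw j) (hpos j)) ⟨i, Finset.mem_univ _⟩).ne hsum

/-- Consensus forces `v X₀ * X₀ ≠ 0`: at a late time the rows lie in an open half-space, where the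
limit vector of that state does not annihilate them, and this property is carried back to the
initial state by the transition matrix. -/
lemma IsLimitVector.rowMul_ne_zero_of_directionConsensus (hn : 0 < n) (hA : ∀ i j, 0 ≤ A i j)
    (hγ : ∀ i, IsDirectional (γ i)) (hdom : DominanceCondition A γ)
    {v : stateSpace γ → EuclideanSpace ℝ (Fin n)} (hv : IsLimitVector A γ v) {t₀ : ℕ}
    {X : ℕ → Matrix (Fin n) (Fin d) ℝ} (hX : IsTrajectory A γ t₀ X) (hcons : DirectionConsensus X) :
    rowMul (v ⟨X t₀, hX.1⟩) (X t₀) ≠ 0 := by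
  let i : Fin n := ⟨0, hn⟩
  have hev : ∀ᶠ t in atTop, ∀ j, ‖dir (row (X t) j) - dir (row (X t) i)‖ < 1 :=
    eventually_all.2 fun j => (hcons j i).eventually_lt_const one_pos
  obtain ⟨t, ht, hclose⟩ := ((eventually_ge_atTop t₀).and hev).exists
  obtain ⟨k, rfl⟩ := Nat.exists_eq_add_of_le ht
  have hXk := hX.shift hA hγ hdom k
  have hne := rowMul_ne_zero_of_norm_dir_sub_lt hγ hXk.1 hclose (hv.2.1 ⟨_, hXk.1⟩).2
  have hmul : rowMul (v ⟨X (t₀ + k), hXk.1⟩) (X (t₀ + k)) =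
      rowMul (rowMul (v ⟨X (t₀ + k), hXk.1⟩) (transition A γ t₀ X k)) (X t₀) := by
    rw [← rowMul_mul, ← hX.eq_transition_mul]
  have hne' : rowMul (v ⟨X (t₀ + k), hXk.1⟩) (transition A γ t₀ X k) ≠ 0 := fun h =>
    hne (by rw [hmul, h, ← rowMulL_apply, map_zero])
  rw [hv.eq_dir_rowMul hn hX hXk hne', dir, rowMul_smul, ← hmul]
  exact smul_ne_zero (inv_ne_zero (norm_ne_zero_iff.2 hne')) hne

lemma IsLimitVector.convergesLinearly_dir_row {v : stateSpace γ → EuclideanSpace ℝ (Fin n)}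
    (hv : IsLimitVector A γ v) {t₀ : ℕ} {X : ℕ → Matrix (Fin n) (Fin d) ℝ}
    (hX : IsTrajectory A γ t₀ X) (hy : rowMul (v ⟨X t₀, hX.1⟩) (X t₀) ≠ 0) (i : Fin n) :
    ConvergesLinearly (fun k => dir (row (X (t₀ + k)) i))
      (dir (rowMul (v ⟨X t₀, hX.1⟩) (X t₀))) := by
  simp only [hX.eq_transition_mul, dir_row_mul]
  exact ((hv.2.2 t₀ X hX i).rowMul (X t₀)).dir hy

end LimitVector

end StarConsensus

open StarConsensus
theorem mainTheorem1 {n d : ℕ} (hn : 0 < n)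
    (G : Digraph (Fin n)) (hG : StronglyConnected G)
    (A : Matrix (Fin n) (Fin n) ℝ) (hA : IsNonnegWeightMatrix G A)
    (γ : Fin n → EuclideanSpace ℝ (Fin d) → ℝ) (hγ : ∀ i, IsDirectional (γ i))
    (hdom : DominanceCondition A γ) :
    (∃! v : stateSpace γ → EuclideanSpace ℝ (Fin n), IsLimitVector A γ v) ∧
    ∀ v : stateSpace γ → EuclideanSpace ℝ (Fin n), IsLimitVector A γ v →
      ∀ (t₀ : ℕ) (X : ℕ → Matrix (Fin n) (Fin d) ℝ) (hX : IsTrajectory A γ t₀ X),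
        let y : EuclideanSpace ℝ (Fin d) := rowMul (v ⟨X t₀, hX.1⟩) (X t₀)
        let Xlim : Matrix (Fin n) (Fin d) ℝ := proj γ (Matrix.of fun _ j => y j)
        (DirectionConsensus X ↔ y ≠ 0) ∧
        (y ≠ 0 →
          (∀ i, Tendsto (fun t => dir (row (X t) i)) atTop (𝓝 (dir y))) ∧
          (∀ i, ConvergesLinearly (fun k => dir (row (X (t₀ + k)) i)) (dir y)) ∧
          Tendsto X atTop (𝓝 Xlim) ∧
          ((∀ i, DifferentiableWithinAt ℝ (γ i) (sphere 0 1) (dir y)) →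
            ∀ i, ConvergesLinearly (fun k => row (X (t₀ + k)) i) (row Xlim i))) := by
  have hA0 : ∀ i j, 0 ≤ A i j := fun i j => by
    by_cases h : G.Adj i j
    · exact ((hA i j).1 h).le
    · exact ((hA i j).2 h).ge
  have hconn : ∀ i j, Relation.ReflTransGen (fun i j => 0 < A i j) i j := fun i j =>
    (hG i j).lift id fun i j => (hA i j).1
  obtain ⟨v₀, hv₀⟩ := exists_isLimitVector hn hA0 hconn hγ hdom
  refine ⟨⟨v₀, hv₀, fun w hw => hw.unique hn hv₀⟩, ?_⟩
  intro v hv t₀ X hX y Xlim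
  have hlin (hy : y ≠ 0) (i : Fin n) :
      ConvergesLinearly (fun k => dir (row (X (t₀ + k)) i)) (dir y) :=
    hv.convergesLinearly_dir_row hX hy i
  have htend (hy : y ≠ 0) (i : Fin n) :
      Tendsto (fun t => dir (row (X t) i)) atTop (𝓝 (dir y)) := by
    rw [← tendsto_add_atTop_iff_nat t₀]
    simpa only [add_comm] using (hlin hy i).tendsto
  refine ⟨⟨hv.rowMul_ne_zero_of_directionConsensus hn hA0 hγ hdom hX, fun hy i j => ?_⟩,
    fun hy => ⟨htend hy, hlin hy, ?_⟩⟩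
  · simpa using ((htend hy i).sub (htend hy j)).norm
  have hmem := hX.mem_stateSpace hA0 hγ hdom
  -- On the state space a row is the function `z ↦ γ i z • z` of its direction.
  have hrow : ∀ k i, row (X (t₀ + k)) i =
      γ i (dir (row (X (t₀ + k)) i)) • dir (row (X (t₀ + k)) i) := fun k i =>
    row_eq_radialProj hγ (hmem k) i
  have hwithin : ∀ i, Tendsto (fun k => dir (row (X (t₀ + k)) i)) atTop
      (𝓝[sphere 0 1] (dir y)) := fun i =>
    tendsto_nhdsWithin_of_tendsto_nhds_of_eventually_within _ (hlin hy i).tendsto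
      (Eventually.of_forall fun k => dir_mem_sphere (row_ne_zero hγ (hmem k) i))
  constructor
  · have hrowlim : ∀ i, Tendsto (fun k => row (X (t₀ + k)) i) atTop (𝓝 (row Xlim i)) := by
      intro i
      have hc : ContinuousWithinAt (fun z => γ i z • z) (sphere 0 1) (dir y) :=
        ((hγ i).1 _ (dir_mem_sphere hy)).smul continuousWithinAt_id
      exact (hc.tendsto.comp (hwithin i)).congr fun k => (hrow k i).symm
    rw [← tendsto_add_atTop_iff_nat t₀]
    refine tendsto_pi_nhds.2 fun i => ?_
    have := ((PiLp.continuous_ofLp 2 _).tendsto _).comp (hrowlim i)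
    exact this.congr fun k => by rw [add_comm]; rfl
  · intro hdiff i
    refine (hlin hy i).of_isBigO ?_
    have hg : DifferentiableWithinAt ℝ (fun z => γ i z • z) (sphere 0 1) (dir y) :=
      (hdiff i).smul differentiableWithinAt_id
    refine (hg.isBigO_sub.comp_tendsto (hwithin i)).congr_left fun k => ?_
    exact congrArg (· - row Xlim i) (hrow k i).symm
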